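/- Let $G$ be a finite multigraph (multiple edges and loops allowed; a loop counts twice toward the degree of its vertex) with vertex set $U$, and let $f:U\to\mathbb{Z}_{\ge 0}$. For a function $g$ on vertices and a set $A$ of vertices put $g(A)=\sum_{v\in A}g(v)$. An $f$-bounded subgraph of $G$ is a spanning subgraph $H$ with $d_H(v)\le f(v)$ for all $v\in U$. For disjoint $S,T\subseteq U$ let $$\mathrm{def}(S,T)=f(T)-f(S)-d_{G-S}(T)+q(S,T),$$ where $d_{G-S}(T)=\sum_{v\in T}d_{G-S}(v)$, and $q(S,T)$ is the number of components of $G-S-T$ whose vertex set $Q$ is such that $f(Q)+\|Q,T\|$ is odd, with $\|Q,T\|$ denoting the number of edges of $G$ joining $Q$ to $T$. Let $h(G;f)$ be the maximum of the degree-sum $d_H(U)$ over all $f$-bounded subgraphs $H$ of $G$. Then $$h(G;f)=\min_{S,T}\bigl[f(U)-\mathrm{def}(S,T)\bigr],$$ where the minimum is over all pairs of disjoint subsets $S,T\subseteq U$. Equivalently, the maximum number of edges in an $f$-bounded subgraph of $G$ is $$\tfrac12\Bigl[f(U)-\max_{S,T}\mathrm{def}(S,T)\Bigr],$$ where the maximum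 is over all pairs of disjoint subsets $S,T\subseteq U$. -/

import Mathlib

namespace Graph

variable {α β : Type*}

/-- `g(A)`: the sum of `g` over the (finite) vertex set `A`. -/
noncomputable def vertexSum (g : α → ℕ) (A : Set α) : ℕ := ∑ᶠ v ∈ A, g v

/-- The degree of `v`: the number of edges at `v`, with loops counted twice. -/
noncomputable def degree (G : Graph α β) (v : α) : ℕ :=
  (G.incidenceSet v).ncard + (G.loopSet v).ncard

/-- `‖A, B‖`: the number of edges with one end in `A` and the other in `B`. -/
noncomputable def numEdgesBetween (G : Graph α β) (A B : Set α) : ℕ :=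
  {e | ∃ x ∈ A, ∃ y ∈ B, G.IsLink e x y}.ncard

/-- The vertex sets of the connected components of `G`. -/
def componentSets (G : Graph α β) : Set (Set α) :=
  {Q | ∃ x ∈ G.vertexSet, Q = {y | Relation.ReflTransGen G.Adj x y}}

/-- `q(S, T)`: the number of components `Q` of `G - S - T` with `f(Q) + ‖Q, T‖` odd. -/
noncomputable def numBad (G : Graph α β) (f : α → ℕ) (S T : Set α) : ℕ :=
  {Q | Q ∈ ((G.deleteVerts S).deleteVerts T).componentSets ∧
    Odd (vertexSum f Q + G.numEdgesBetween Q T)}.ncard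

/-- `def(S, T) = f(T) - f(S) - d_{G-S}(T) + q(S, T)`. -/
noncomputable def deficiency (G : Graph α β) (f : α → ℕ) (S T : Set α) : ℤ :=
  (vertexSum f T : ℤ) - (vertexSum f S : ℤ)
    - (vertexSum (G.deleteVerts S).degree T : ℤ) + (G.numBad f S T : ℤ)

/-- `H` is an `f`-bounded subgraph of `G`: a spanning subgraph with `d_H(v) ≤ f(v)` for every
vertex `v`. -/
def IsBoundedSubgraph (H G : Graph α β) (f : α → ℕ) : Prop :=
  H.IsSpanningSubgraph G ∧ ∀ v ∈ G.vertexSet, H.degree v ≤ f v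

end Graph

/-
`f`-bounded subgraphs of `G` are encoded by matchings of an auxiliary simple graph, the gadget: its
vertices are the darts (oriented edges) of `G` and `f v` copies of every vertex `v`, and every dart
is joined to its reverse and to the copies of the vertex it leaves. An edge belongs to the subgraph
if both its darts are matched to copies, so unmatched gadget vertices measure the loss in degree.

By the Tutte–Berge formula some matching leaves at most `o(X) - |X|` gadget vertices unmatched,
where `X` maximises this quantity and `o(X)` counts the odd components left by deleting `X`. If `X`
is smallest possible, each of its vertices has neighbours in at least three components of the rest.
This forces `X` to consist of all copies of the vertices in a set `S` and all darts leaving a set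
`T` disjoint from `S`, and counting the odd components then gives `o(X) - |X| ≤ def(S, T)`.

Conversely, let `H` be `f`-bounded. In a component `Q` of `G - S - T` counted by `q(S, T)`, parity
forces an edge of `H` to `S`, an edge to `T` outside `H`, or a vertex with `d_H(v) < f(v)`; summing
these contributions bounds `def(S, T)` by `f(U) - d_H(U)`.
-/

namespace BoundedSubgraph

section TutteBerge

open SimpleGraph

variable {V W : Type*} {Γ : SimpleGraph V}

lemma reachable_mem_of_closed {A : Set V} (hA : ∀ x ∈ A, ∀ y, Γ.Adj x y → y ∈ A) {x y : V}
    (hx : x ∈ A) (h : Γ.Reachable x y) : y ∈ A := by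
  obtain ⟨p⟩ := h
  induction p with
  | nil => exact hx
  | cons hadj _ ih => exact ih (hA _ hx _ hadj)

lemma supp_eq_of_closed {A : Set V} {x : V} (hx : x ∈ A)
    (hclosed : ∀ y ∈ A, ∀ z, Γ.Adj y z → z ∈ A) (hreach : ∀ y ∈ A, Γ.Reachable x y) :
    (Γ.connectedComponentMk x).supp = A := by
  ext y
  rw [ConnectedComponent.mem_supp_iff, ConnectedComponent.eq]
  exact ⟨fun h => reachable_mem_of_closed hclosed hx h.symm, fun hy => (hreach y hy).symm⟩

lemma supp_eq_singleton {x : V} (hx : ∀ y, ¬ Γ.Adj x y) :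
    (Γ.connectedComponentMk x).supp = {x} := by
  refine supp_eq_of_closed rfl ?_ ?_
  · rintro _ rfl y hy
    exact (hx y hy).elim
  · rintro _ rfl
    exact .rfl

lemma supp_map_embedding {Δ : SimpleGraph W} (φ : Δ ↪g Γ)
    (hφ : ∀ x ∉ Set.range φ, ∀ y, ¬ Γ.Adj x y) (c : Δ.ConnectedComponent) :
    (c.map φ.toHom).supp = φ '' c.supp := by
  induction c using ConnectedComponent.ind with | _ x
  refine supp_eq_of_closed ⟨x, rfl, rfl⟩ ?_ ?_
  · rintro _ ⟨y, hy, rfl⟩ z hz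
    obtain ⟨z, rfl⟩ : z ∈ Set.range φ := by
      by_contra hzφ
      exact hφ z hzφ _ hz.symm
    exact ⟨z, (ConnectedComponent.mem_supp_congr_adj _ (φ.map_adj_iff.1 hz)).1 hy, rfl⟩
  · rintro _ ⟨y, hy, rfl⟩
    exact (ConnectedComponent.exact hy).symm.map φ.toHom

lemma ncard_oddComponents_embedding [Finite V] {Δ : SimpleGraph W} (φ : Δ ↪g Γ)
    (hφ : ∀ x ∉ Set.range φ, ∀ y, ¬ Γ.Adj x y) :
    Γ.oddComponents.ncard = Δ.oddComponents.ncard + (Set.range φ)ᶜ.ncard := by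
  have hmap : Function.Injective (ConnectedComponent.map φ.toHom) := fun c d hcd => by
    have hsupp := congrArg ConnectedComponent.supp hcd
    rw [supp_map_embedding φ hφ, supp_map_embedding φ hφ] at hsupp
    exact ConnectedComponent.supp_injective (φ.injective.image_injective hsupp)
  have hmk : Set.InjOn Γ.connectedComponentMk (Set.range φ)ᶜ := fun x hx y hy hxy => by
    have hsupp := congrArg ConnectedComponent.supp hxy
    rwa [supp_eq_singleton (hφ x hx), supp_eq_singleton (hφ y hy), Set.singleton_eq_singleton_iff]
      at hsupp
  have hodd (c : Δ.ConnectedComponent) :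
      c.map φ.toHom ∈ Γ.oddComponents ↔ c ∈ Δ.oddComponents := by
    simp only [Set.mem_ofPred_eq, supp_map_embedding φ hφ,
      Set.ncard_image_of_injective _ φ.injective]
  have hunion : Γ.oddComponents = ConnectedComponent.map φ.toHom '' Δ.oddComponents ∪
      Γ.connectedComponentMk '' (Set.range φ)ᶜ := by
    ext c
    constructor
    · intro hc
      induction c using ConnectedComponent.ind with | _ x
      by_cases hx : x ∈ Set.range φ
      · obtain ⟨x, rfl⟩ := hx
        exact .inl ⟨Δ.connectedComponentMk x, (hodd _).1 hc, rfl⟩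
      · exact .inr ⟨x, hx, rfl⟩
    · rintro (⟨c, hc, rfl⟩ | ⟨x, hx, rfl⟩)
      · exact (hodd c).2 hc
      · simp [supp_eq_singleton (hφ x hx)]
  rw [hunion, Set.ncard_union_eq ?_ (Set.toFinite _) (Set.toFinite _),
    Set.ncard_image_of_injective _ hmap, hmk.ncard_image]
  rw [Set.disjoint_left]
  rintro _ ⟨c, -, rfl⟩ ⟨x, hx, hxc⟩
  have hxsupp : x ∈ (c.map φ.toHom).supp := hxc
  rw [supp_map_embedding φ hφ] at hxsupp
  exact hx (Set.image_subset_range _ _ hxsupp)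

/-- The graph obtained from `Γ` by deleting every edge that meets `X`. It stands in for `Γ - X` on
the same vertex type: its odd components are those of `Γ - X` and the `|X|` singletons of `X`. -/
def isolate (Γ : SimpleGraph V) (X : Set V) : SimpleGraph V where
  Adj x y := Γ.Adj x y ∧ x ∉ X ∧ y ∉ X
  symm := ⟨fun _ _ h => ⟨h.1.symm, h.2.2, h.2.1⟩⟩
  loopless := ⟨fun _ h => h.1.ne rfl⟩

lemma ncard_oddComponents_isolate [Finite V] (X : Set V) :
    (isolate Γ X).oddComponents.ncard =
      ((⊤ : Γ.Subgraph).deleteVerts X).coe.oddComponents.ncard + X.ncard := by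
  let φ : ((⊤ : Γ.Subgraph).deleteVerts X).coe ↪g isolate Γ X :=
    ⟨.subtype _, fun {a b} => by
      have ha : (a : V) ∉ X := a.2.2
      have hb : (b : V) ∉ X := b.2.2
      simp [isolate, ha, hb]⟩
  have hrange : Set.range φ = Xᶜ := by
    ext x
    simp [φ]
  rw [ncard_oddComponents_embedding φ, hrange, compl_compl]
  intro x hx y hxy
  rw [hrange, Set.notMem_compl_iff] at hx
  exact hxy.2.1 hx

lemma exists_isPerfectMatching [Finite V] (h : ∀ X : Set V,
    (isolate Γ X).oddComponents.ncard ≤ 2 * X.ncard) :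
    ∃ M : Γ.Subgraph, M.IsPerfectMatching := by
  rw [tutte]
  intro X hX
  have hX' := h X
  rw [ncard_oddComponents_isolate] at hX'
  simp only [IsTutteViolator] at hX
  omega

/-- The join of `Γ` with the complete graph on `D`. -/
def joinComplete (Γ : SimpleGraph V) (D : Type*) : SimpleGraph (V ⊕ D) where
  Adj
    | .inl x, .inl y => Γ.Adj x y
    | a, b => a ≠ b
  symm := ⟨by rintro (x | x) (y | y) h <;> simp_all [Γ.adj_comm, eq_comm]⟩
  loopless := ⟨by rintro (x | x) h <;> simp_all⟩

lemma ncard_oddComponents_isolate_joinComplete [Finite V] {D : Type*} [Finite D]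
    {Y : Set (V ⊕ D)} (hY : ∀ i, .inr i ∈ Y) :
    (isolate (joinComplete Γ D) Y).oddComponents.ncard =
      (isolate Γ (Sum.inl ⁻¹' Y)).oddComponents.ncard + Nat.card D := by
  let φ : isolate Γ (Sum.inl ⁻¹' Y) ↪g isolate (joinComplete Γ D) Y := ⟨.inl, .rfl⟩
  have hrange : (Set.range φ)ᶜ = Set.range Sum.inr := Set.compl_range_inl
  rw [ncard_oddComponents_embedding φ, hrange, ← Set.image_univ,
    Set.ncard_image_of_injective _ Sum.inr_injective, Set.ncard_univ]
  intro x hx y hxy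
  obtain ⟨i, rfl⟩ : x ∈ Set.range Sum.inr := hrange ▸ hx
  exact hxy.2.1 (hY i)

lemma ncard_oddComponents_isolate_le_of_universal [Finite V] {X : Set V} {u : V} (hu : u ∉ X)
    (hadj : ∀ x, x ≠ u → Γ.Adj u x) : (isolate Γ X).oddComponents.ncard ≤ X.ncard + 1 := by
  have hsub : (isolate Γ X).oddComponents ⊆ (isolate Γ X).connectedComponentMk '' insert u X := by
    intro c _
    induction c using ConnectedComponent.ind with | _ x
    by_cases hx : x ∈ X
    · exact ⟨x, .inr hx, rfl⟩
    · refine ⟨u, .inl rfl, ConnectedComponent.sound ?_⟩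
      by_cases hxu : x = u
      · rw [hxu]
      · exact Adj.reachable ⟨hadj x hxu, hu, hx⟩
  exact (Set.ncard_le_ncard hsub).trans ((Set.ncard_image_le).trans (Set.ncard_insert_le u X))

lemma ncard_eq_ncard_preimage_inl_add {ι κ : Type*} [Finite ι] [Finite κ] (A : Set (ι ⊕ κ)) :
    A.ncard = (Sum.inl ⁻¹' A).ncard + (Sum.inr ⁻¹' A).ncard := by
  rw [← Set.ncard_image_of_injective (Sum.inl ⁻¹' A) Sum.inl_injective,
    ← Set.ncard_image_of_injective (Sum.inr ⁻¹' A) Sum.inr_injective, ← Set.ncard_union_eq,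
    Set.image_preimage_inl_union_image_preimage_inr]
  rw [Set.disjoint_left]
  rintro _ ⟨x, -, rfl⟩ ⟨y, -, h⟩
  cases h

lemma exists_isPerfectMatching_joinComplete [Finite V] {D : Type*} [Finite D]
    (hodd : ∀ X : Set V, (isolate Γ X).oddComponents.ncard ≤ 2 * X.ncard + Nat.card D)
    (hpar : Even (Nat.card V + Nat.card D)) :
    ∃ M : (joinComplete Γ D).Subgraph, M.IsPerfectMatching := by
  refine exists_isPerfectMatching fun Y => ?_
  by_cases hY : ∀ i, .inr i ∈ Y
  · have hcard : Y.ncard = (Sum.inl ⁻¹' Y).ncard + Nat.card D := by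
      rw [ncard_eq_ncard_preimage_inl_add, Set.eq_univ_of_forall (s := Sum.inr ⁻¹' Y) hY,
        Set.ncard_univ]
    have hX := hodd (Sum.inl ⁻¹' Y)
    rw [ncard_oddComponents_isolate_joinComplete hY]
    omega
  · obtain ⟨i, hi⟩ := not_forall.1 hY
    have hle := ncard_oddComponents_isolate_le_of_universal (Γ := joinComplete Γ D) hi <| by
      rintro (x | j) hne <;> exact hne.symm
    have hparY := (isolate (joinComplete Γ D) Y).odd_ncard_oddComponents
    rw [Nat.card_sum, ← not_iff_not, Nat.not_odd_iff_even, Nat.not_odd_iff_even] at hparY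
    have heven := hparY.2 hpar
    rw [Nat.even_iff] at heven
    omega

lemma ncard_le_ncard_of_isMatching [Finite V] {M : Γ.Subgraph} (hM : M.IsMatching) {A B : Set V}
    (h : ∀ a ∈ A, ∃ b ∈ B, M.Adj a b) : A.ncard ≤ B.ncard := by
  choose! g hgB hg using h
  exact Set.ncard_le_ncard_of_injOn g hgB fun a ha b hb hab =>
    hM.eq_of_adj_right (hg a ha) (hab ▸ hg b hb)

lemma exists_isMatching_of_joinComplete [Finite V] {D : Type*} [Finite D]
    {M : (joinComplete Γ D).Subgraph} (hM : M.IsPerfectMatching) :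
    ∃ N : Γ.Subgraph, N.IsMatching ∧ N.vertsᶜ.ncard ≤ Nat.card D := by
  choose m hm huniq using Subgraph.isPerfectMatching_iff.1 hM
  refine ⟨{ verts := {x | ∃ y, M.Adj (.inl x) (.inl y)}
            Adj := fun x y => M.Adj (.inl x) (.inl y)
            adj_sub := fun h => M.adj_sub h
            edge_vert := fun h => ⟨_, h⟩
            symm := ⟨fun _ _ h => h.symm⟩ }, ?_, ?_⟩
  · rintro x ⟨y, hxy⟩
    exact ⟨y, hxy, fun z hxz => Sum.inl_injective ((huniq _ _ hxz).trans (huniq _ _ hxy).symm)⟩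
  · rw [← Set.ncard_image_of_injective _ (Sum.inl_injective (β := D)), ← Set.ncard_univ,
      ← Set.ncard_image_of_injective Set.univ Sum.inr_injective]
    refine ncard_le_ncard_of_isMatching hM.1 ?_
    rintro _ ⟨x, hx, rfl⟩
    rcases hmx : m (.inl x) with y | i
    · exact (hx ⟨y, hmx ▸ hm _⟩).elim
    · exact ⟨.inr i, ⟨i, trivial, rfl⟩, hmx ▸ hm _⟩

/-- The deficiency `o(Γ - X) - |X|` of the Tutte–Berge formula, expressed through `isolate Γ X`,
which has `|X|` more odd components than `Γ - X`. -/
noncomputable def bergeDeficiency (Γ : SimpleGraph V) (X : Set V) : ℤ :=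
  (isolate Γ X).oddComponents.ncard - 2 * X.ncard

lemma exists_isMatching_of_forall_bergeDeficiency_le [Finite V] {X : Set V}
    (hX : ∀ Y, bergeDeficiency Γ Y ≤ bergeDeficiency Γ X) :
    ∃ M : Γ.Subgraph, M.IsMatching ∧ (M.vertsᶜ.ncard : ℤ) ≤ bergeDeficiency Γ X := by
  have hnonneg : 0 ≤ bergeDeficiency Γ X := le_trans (by simp [bergeDeficiency]) (hX ∅)
  obtain ⟨d, hd⟩ := Int.eq_ofNat_of_zero_le hnonneg
  have hodd (Y : Set V) : (isolate Γ Y).oddComponents.ncard ≤ 2 * Y.ncard + Nat.card (Fin d) := by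
    have hY := (hX Y).trans_eq hd
    simp only [bergeDeficiency] at hY
    simp only [Nat.card_fin]
    omega
  have hpar : Even (Nat.card V + Nat.card (Fin d)) := by
    have hparX := (isolate Γ X).odd_ncard_oddComponents
    simp only [bergeDeficiency] at hd
    simp only [Nat.odd_iff, Nat.even_iff, Nat.card_fin] at hparX ⊢
    omega
  obtain ⟨P, hP⟩ := exists_isPerfectMatching_joinComplete hodd hpar
  obtain ⟨M, hM, hMd⟩ := exists_isMatching_of_joinComplete hP
  refine ⟨M, hM, ?_⟩
  rw [hd]
  exact_mod_cast hMd.trans_eq (Nat.card_fin d)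

/-- `x` has neighbours in at least three components of `Γ - X`: no two components of `Γ - X`
contain all its neighbours outside `X`. -/
def MeetsThreeComponents (Γ : SimpleGraph V) (X : Set V) (x : V) : Prop :=
  ∀ y₁ y₂, ∃ y, Γ.Adj x y ∧ y ∉ X ∧ ¬ (isolate Γ X).Reachable y₁ y ∧ ¬ (isolate Γ X).Reachable y₂ y

lemma supp_isolate_sdiff_singleton {X : Set V} {x z : V} (hzx : ¬ (isolate Γ X).Reachable z x)
    (hnbr : ∀ y, Γ.Adj x y → y ∉ X → ¬ (isolate Γ X).Reachable z y) :
    ((isolate Γ (X \ {x})).connectedComponentMk z).supp =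
      ((isolate Γ X).connectedComponentMk z).supp := by
  have hle : isolate Γ X ≤ isolate Γ (X \ {x}) := fun a b hab =>
    ⟨hab.1, fun h => hab.2.1 h.1, fun h => hab.2.2 h.1⟩
  refine supp_eq_of_closed rfl ?_ fun y hy => (ConnectedComponent.exact hy).symm.mono hle
  intro a ha b hab
  have hza : (isolate Γ X).Reachable z a := (ConnectedComponent.exact ha).symm
  have haX : a ∉ X := fun h => hab.2.1 ⟨h, fun hax => hzx (hax ▸ hza)⟩
  have hbX : b ∉ X := fun h => hab.2.2 ⟨h, fun hbx => hnbr a (hbx ▸ hab.1.symm) haX hza⟩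
  have hadj : (isolate Γ X).Adj a b := ⟨hab.1, haX, hbX⟩
  exact (ConnectedComponent.mem_supp_congr_adj _ hadj).1 ha

lemma ncard_oddComponents_isolate_le_sdiff_singleton [Finite V] {X : Set V} {x : V}
    (hx : ¬ MeetsThreeComponents Γ X x) :
    (isolate Γ X).oddComponents.ncard ≤ (isolate Γ (X \ {x})).oddComponents.ncard + 3 := by
  simp only [MeetsThreeComponents, not_forall, not_exists, not_and, not_not] at hx
  obtain ⟨y₁, y₂, hy⟩ := hx
  let C := (isolate Γ X).connectedComponentMk
  let N : Set (Set V) := {(C x).supp, (C y₁).supp, (C y₂).supp}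
  have hN : N.ncard ≤ 3 := by
    have hpair := Set.ncard_insert_le (C y₁).supp {(C y₂).supp}
    rw [Set.ncard_singleton] at hpair
    exact (Set.ncard_insert_le _ _).trans (Nat.succ_le_succ hpair)
  have hsub : ConnectedComponent.supp '' (isolate Γ X).oddComponents ⊆
      ConnectedComponent.supp '' (isolate Γ (X \ {x})).oddComponents ∪ N := by
    rintro _ ⟨c, hc, rfl⟩
    induction c using ConnectedComponent.ind with | _ z
    by_cases hzN : (C z).supp ∈ N
    · exact .inr hzN
    have hz (y : V) (hyN : (C y).supp ∈ N) : ¬ (isolate Γ X).Reachable z y := fun hzy =>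
      hzN (by rwa [show C z = C y from ConnectedComponent.sound hzy])
    have hsupp := supp_isolate_sdiff_singleton (hz x (by simp [N])) fun y hxy hyX hzy => by
      by_cases hy₁ : (isolate Γ X).Reachable y₁ y
      · exact hz y₁ (by simp [N]) (hzy.trans hy₁.symm)
      · exact hz y₂ (by simp [N]) (hzy.trans (hy y hxy hyX hy₁).symm)
    exact .inl ⟨(isolate Γ (X \ {x})).connectedComponentMk z, by
      rwa [Set.mem_ofPred_eq, hsupp], hsupp⟩
  have hcard := (Set.ncard_le_ncard hsub).trans (Set.ncard_union_le _ _)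
  rw [Set.ncard_image_of_injective _ ConnectedComponent.supp_injective,
    Set.ncard_image_of_injective _ ConnectedComponent.supp_injective] at hcard
  omega

lemma bergeDeficiency_le_sdiff_singleton [Finite V] {X : Set V} {x : V} (hxX : x ∈ X)
    (hx : ¬ MeetsThreeComponents Γ X x) :
    bergeDeficiency Γ X ≤ bergeDeficiency Γ (X \ {x}) := by
  have hle := ncard_oddComponents_isolate_le_sdiff_singleton hx
  have hcard := Set.ncard_sdiff_singleton_add_one hxX
  have hpar := (isolate Γ X).odd_ncard_oddComponents
  rw [← (isolate Γ (X \ {x})).odd_ncard_oddComponents] at hpar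
  simp only [Nat.odd_iff] at hpar
  simp only [bergeDeficiency]
  omega

theorem exists_barrier_and_isMatching [Finite V] (Γ : SimpleGraph V) :
    ∃ (X : Set V) (M : Γ.Subgraph), (∀ x ∈ X, MeetsThreeComponents Γ X x) ∧ M.IsMatching ∧
      2 * X.ncard + M.vertsᶜ.ncard ≤ (isolate Γ X).oddComponents.ncard := by
  obtain ⟨Z, hZ⟩ := Finite.exists_max (bergeDeficiency Γ)
  obtain ⟨X, hX, hmin⟩ := Set.exists_min_image {X | bergeDeficiency Γ X = bergeDeficiency Γ Z}
    Set.ncard (Set.toFinite _) ⟨Z, rfl⟩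
  have hmax (Y : Set V) : bergeDeficiency Γ Y ≤ bergeDeficiency Γ X := (hZ Y).trans_eq hX.symm
  obtain ⟨M, hM, hMX⟩ := exists_isMatching_of_forall_bergeDeficiency_le hmax
  refine ⟨X, M, fun x hx => ?_, hM, ?_⟩
  · by_contra hthree
    have hle := hmin (X \ {x})
      ((hZ _).antisymm (hX.symm.trans_le (bergeDeficiency_le_sdiff_singleton hx hthree)))
    have hcard := Set.ncard_sdiff_singleton_add_one hx
    omega
  · simp only [bergeDeficiency] at hMX
    omega

end TutteBerge

section VertexSums

variable {α : Type*} {g h : α → ℕ} {A B : Set α}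

lemma vertexSum_eq_sum (hA : A.Finite) : Graph.vertexSum g A = ∑ v ∈ hA.toFinset, g v :=
  finsum_mem_eq_finite_toFinset_sum g hA

lemma vertexSum_add (hA : A.Finite) :
    Graph.vertexSum (fun v => g v + h v) A = Graph.vertexSum g A + Graph.vertexSum h A :=
  finsum_mem_add_distrib hA

lemma vertexSum_union (hA : A.Finite) (hB : B.Finite) (hAB : Disjoint A B) :
    Graph.vertexSum g (A ∪ B) = Graph.vertexSum g A + Graph.vertexSum g B :=
  finsum_mem_union hAB hA hB

lemma vertexSum_mono (hA : A.Finite) (hgh : ∀ v ∈ A, g v ≤ h v) :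
    Graph.vertexSum g A ≤ Graph.vertexSum h A := by
  rw [vertexSum_eq_sum hA, vertexSum_eq_sum hA]
  exact Finset.sum_le_sum fun v hv => hgh v (hA.mem_toFinset.1 hv)

lemma vertexSum_congr (hgh : ∀ v ∈ A, g v = h v) : Graph.vertexSum g A = Graph.vertexSum h A :=
  finsum_mem_congr rfl hgh

lemma vertexSum_ncard_fiber {ι : Type*} {D : Set ι} (hD : D.Finite) (φ : ι → α) (hA : A.Finite) :
    Graph.vertexSum (fun v => {i ∈ D | φ i = v}.ncard) A = {i ∈ D | φ i ∈ A}.ncard := by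
  rw [Graph.vertexSum, ← hA.ncard_biUnion (fun v _ => hD.subset (Set.sep_subset D _))]
  · congr 1
    ext i
    simp
  · exact fun v _ w _ hvw => Set.disjoint_left.2 fun i hi hi' => hvw (hi.2.symm.trans hi'.2)

end VertexSums

section Darts

open Graph

variable {α β : Type*} {G H : Graph α β}

/-- An edge of `G` together with one of its two orientations. A loop has two orientations as well,
so the number of darts leaving a vertex is its degree. -/
@[ext]
structure Dart (G : Graph α β) where
  edge : E(G)
  forward : Bool

namespace Dart

/-- The start of a dart. Which end of an edge its forward orientation leaves is chosen
arbitrarily. -/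
noncomputable def tail (d : Dart G) : α :=
  bif d.forward then (exists_isLink_of_mem_edgeSet d.edge.2).choose
  else (exists_isLink_of_mem_edgeSet d.edge.2).choose_spec.choose

/-- The other orientation of the same edge. -/
def rev (d : Dart G) : Dart G := ⟨d.edge, !d.forward⟩

/-- The end of a dart. -/
noncomputable def head (d : Dart G) : α := d.rev.tail

@[simp] lemma rev_rev (d : Dart G) : d.rev.rev = d := by simp [rev]

lemma rev_ne (d : Dart G) : d.rev ≠ d := by simp [rev, Dart.ext_iff]

@[simp] lemma edge_rev (d : Dart G) : d.rev.edge = d.edge := rfl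

@[simp] lemma tail_rev (d : Dart G) : d.rev.tail = d.head := rfl

@[simp] lemma head_rev (d : Dart G) : d.rev.head = d.tail := by rw [head, rev_rev]

lemma isLink (d : Dart G) : G.IsLink d.edge d.tail d.head := by
  have h := (exists_isLink_of_mem_edgeSet d.edge.2).choose_spec.choose_spec
  rcases d with ⟨e, _ | _⟩
  exacts [h.symm, h]

lemma exists_of_isLink {e : β} {x y : α} (h : G.IsLink e x y) :
    ∃ d : Dart G, d.edge = e ∧ d.tail = x ∧ d.head = y := by
  let d : Dart G := ⟨⟨e, h.edge_mem⟩, true⟩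
  rcases d.isLink.eq_and_eq_or_eq_and_eq h with ⟨hx, hy⟩ | ⟨hx, hy⟩
  · exact ⟨d, rfl, hx, hy⟩
  · exact ⟨d.rev, rfl, by simpa using hy, by simpa using hx⟩

instance [Finite E(G)] : Finite (Dart G) :=
  .of_injective (fun d => (d.edge, d.forward)) fun d d' h => by simpa [Dart.ext_iff] using h

lemma eq_or_eq_rev {d d' : Dart G} (h : d.edge = d'.edge) : d = d' ∨ d = d'.rev := by
  rcases d with ⟨e, _ | _⟩ <;> rcases d' with ⟨e', _ | _⟩ <;> simp_all [rev]

lemma ncard_eq_add [Finite E(G)] (D : Set (Dart G)) :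
    D.ncard = {e | ⟨e, true⟩ ∈ D}.ncard + {e | ⟨e, false⟩ ∈ D}.ncard := by
  have hinj (b : Bool) : Function.Injective fun e : E(G) => (⟨e, b⟩ : Dart G) :=
    fun e e' h => congrArg Dart.edge h
  rw [← Set.ncard_image_of_injective _ (hinj true), ← Set.ncard_image_of_injective _ (hinj false),
    ← Set.ncard_union_eq]
  · congr 1
    ext ⟨e, _ | _⟩ <;> simp
  · rw [Set.disjoint_left]
    rintro _ ⟨e, -, rfl⟩ ⟨e', -, h⟩
    simp at h

lemma ncard_eq_two_mul [Finite E(G)] {D : Set (Dart G)} (hD : ∀ d ∈ D, d.rev ∈ D) :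
    D.ncard = 2 * (Dart.edge '' D).ncard := by
  have himage (b : Bool) : {e | ⟨e, b⟩ ∈ D} = Dart.edge '' D := by
    ext e
    refine ⟨fun he => ⟨⟨e, b⟩, he, rfl⟩, ?_⟩
    rintro ⟨d, hd, rfl⟩
    rcases eq_or_eq_rev (d := ⟨d.edge, b⟩) (d' := d) rfl with h | h
    · rwa [Set.mem_ofPred_eq, h]
    · rw [Set.mem_ofPred_eq, h]
      exact hD d hd
  rw [ncard_eq_add, himage, himage, two_mul]

end Dart

/-- The number of darts of `G` from `A` to `B` along edges in `K`. An edge with both ends in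
`A ∩ B` counts twice. -/
noncomputable def numDarts (G : Graph α β) (K : Set β) (A B : Set α) : ℕ :=
  {d : Dart G | ↑d.edge ∈ K ∧ d.tail ∈ A ∧ d.head ∈ B}.ncard

variable {K : Set β} {A A' B B' : Set α}

lemma numDarts_comm : numDarts G K A B = numDarts G K B A := by
  have hrev : Function.Involutive (Dart.rev (G := G)) := Dart.rev_rev
  rw [numDarts, ← Set.ncard_image_of_injective _ hrev.injective, hrev.image_eq_preimage_symm,
    numDarts]
  congr 1
  ext d
  simp [and_comm]

lemma numDarts_vertexSet_left : numDarts G K V(G) B = numDarts G K .univ B := by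
  simp [numDarts, Dart.isLink _ |>.left_mem]

variable [Finite E(G)]

lemma numDarts_mono (hA : A ⊆ A') (hB : B ⊆ B') : numDarts G K A B ≤ numDarts G K A' B' :=
  Set.ncard_le_ncard fun _ h => ⟨h.1, hA h.2.1, hB h.2.2⟩

lemma numDarts_union_left (h : Disjoint A A') :
    numDarts G K (A ∪ A') B = numDarts G K A B + numDarts G K A' B := by
  rw [numDarts, numDarts, numDarts, ← Set.ncard_union_eq]
  · congr 1
    ext d
    simp only [Set.mem_union, Set.mem_ofPred_eq]
    tauto
  · exact Set.disjoint_left.2 fun d hd hd' => Set.disjoint_left.1 h hd.2.1 hd'.2.1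

lemma numDarts_union_right (h : Disjoint B B') :
    numDarts G K A (B ∪ B') = numDarts G K A B + numDarts G K A B' := by
  simp only [numDarts_comm (A := A), numDarts_union_left h]

lemma numDarts_add_numDarts_compl :
    numDarts G K A B + numDarts G Kᶜ A B = numDarts G E(G) A B := by
  rw [numDarts, numDarts, numDarts, ← Set.ncard_union_eq]
  · congr 1
    ext d
    simp only [Set.mem_union, Set.mem_ofPred_eq, Set.mem_compl_iff, d.edge.2]
    tauto
  · exact Set.disjoint_left.2 fun d hd hd' => hd'.1 hd.1

lemma even_numDarts_self : Even (numDarts G K A A) := by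
  rw [numDarts, Dart.ncard_eq_two_mul]
  · exact even_two_mul _
  · exact fun d hd => ⟨hd.1, hd.2.2, by simpa using hd.2.1⟩

lemma numDarts_univ_univ (hK : K ⊆ E(G)) : numDarts G K .univ .univ = 2 * K.ncard := by
  rw [numDarts, Dart.ncard_eq_two_mul (by simp),
    ← Set.ncard_image_of_injective _ Subtype.val_injective]
  congr 2
  ext e
  constructor
  · rintro ⟨_, ⟨d, hd, rfl⟩, rfl⟩
    exact hd.1
  · exact fun he => ⟨_, ⟨⟨⟨e, hK he⟩, true⟩, ⟨he, trivial, trivial⟩, rfl⟩, rfl⟩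

lemma numDarts_edgeSet (hH : H ≤ G) : numDarts G E(H) A B =
    H.numEdgesBetween A B + H.numEdgesBetween (A ∩ B) (A ∩ B) := by
  have hlink (d : Dart G) (hd : ↑d.edge ∈ E(H)) : H.IsLink d.edge d.tail d.head :=
    (hH.isLink_iff hd).2 d.isLink
  let F (b : Bool) : Set E(G) :=
    {e | (⟨e, b⟩ : Dart G) ∈ {d : Dart G | ↑d.edge ∈ E(H) ∧ d.tail ∈ A ∧ d.head ∈ B}}
  have hunion : {e | ∃ x ∈ A, ∃ y ∈ B, H.IsLink e x y} = Subtype.val '' (F true ∪ F false) := by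
    ext e
    constructor
    · rintro ⟨x, hx, y, hy, he⟩
      obtain ⟨⟨e, b⟩, rfl, rfl, rfl⟩ := Dart.exists_of_isLink (hH.isLink_mono he)
      have hF : e ∈ F b := ⟨he.edge_mem, hx, hy⟩
      exact ⟨e, by cases b <;> simp [hF], rfl⟩
    · rintro ⟨e, he | he, rfl⟩ <;> exact ⟨_, he.2.1, _, he.2.2, hlink _ he.1⟩
  have hinter : {e | ∃ x ∈ A ∩ B, ∃ y ∈ A ∩ B, H.IsLink e x y} =
      Subtype.val '' (F true ∩ F false) := by
    ext e
    constructor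
    · rintro ⟨x, hx, y, hy, he⟩
      obtain ⟨d, rfl, rfl, rfl⟩ := Dart.exists_of_isLink (hH.isLink_mono he)
      have hF (b : Bool) : d.edge ∈ F b := by
        rcases Dart.eq_or_eq_rev (d := ⟨d.edge, b⟩) (d' := d) rfl with h | h
        · exact ⟨he.edge_mem, by rw [h]; exact ⟨hx.1, hy.2⟩⟩
        · exact ⟨he.edge_mem, by rw [h]; exact ⟨hy.1, by simpa using hx.2⟩⟩
      exact ⟨d.edge, ⟨hF _, hF _⟩, rfl⟩
    · rintro ⟨e, ⟨⟨he, htA, hhB⟩, -, hhA, htB⟩, rfl⟩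
      exact ⟨_, ⟨htA, htB⟩, _, ⟨hhA, hhB⟩, hlink ⟨e, true⟩ he⟩
  rw [numDarts, Dart.ncard_eq_add, numEdgesBetween, numEdgesBetween, hunion, hinter,
    Set.ncard_image_of_injective _ Subtype.val_injective,
    Set.ncard_image_of_injective _ Subtype.val_injective, Set.ncard_union_add_ncard_inter]

lemma numDarts_eq_numEdgesBetween (h : Disjoint A B) :
    numDarts G E(G) A B = G.numEdgesBetween A B := by
  rw [numDarts_edgeSet le_rfl, h.inter_eq]
  simp [numEdgesBetween]

lemma degree_eq_numDarts (hH : H ≤ G) (v : α) : H.degree v = numDarts G E(H) {v} .univ := by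
  rw [numDarts_edgeSet hH, Set.inter_univ]
  simp only [degree, numEdgesBetween, incidenceSet, Inc, loopSet, IsLoopAt, Set.mem_singleton_iff,
    exists_eq_left, Set.mem_univ, true_and]

lemma vertexSum_numDarts (hA : A.Finite) :
    vertexSum (fun v => numDarts G K {v} B) A = numDarts G K A B := by
  simpa [numDarts, and_assoc, and_comm, and_left_comm] using
    vertexSum_ncard_fiber (D := {d : Dart G | ↑d.edge ∈ K ∧ d.head ∈ B}) (Set.toFinite _)
      Dart.tail hA

lemma vertexSum_degree (hH : H ≤ G) (hA : A.Finite) :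
    vertexSum H.degree A = numDarts G E(H) A .univ := by
  simp only [vertexSum_congr fun v _ => degree_eq_numDarts hH v, vertexSum_numDarts hA]

lemma vertexSum_degree_vertexSet (hV : V(G).Finite) : vertexSum G.degree V(G) = 2 * E(G).ncard := by
  rw [vertexSum_degree le_rfl hV, numDarts_vertexSet_left, numDarts_univ_univ subset_rfl]

lemma vertexSum_degree_deleteVerts {S T : Set α} (hT : T.Finite) (hST : Disjoint S T) :
    vertexSum (G.deleteVerts S).degree T = numDarts G E(G) T Sᶜ := by
  have hedge (d : Dart G) : ↑d.edge ∈ E(G.deleteVerts S) ↔ d.tail ∉ S ∧ d.head ∉ S :=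
    ⟨fun h => ((G.deleteVerts_isLink S).1 ((G.deleteVerts_le.isLink_iff h).2 d.isLink)).2,
      fun h => ((G.deleteVerts_isLink S).2 ⟨d.isLink, h⟩).edge_mem⟩
  rw [vertexSum_degree G.deleteVerts_le hT, numDarts, numDarts]
  congr 1
  ext d
  have hdT : d.tail ∈ T → d.tail ∉ S := fun h h' => Set.disjoint_left.1 hST h' h
  simp only [Set.mem_ofPred_eq, hedge, d.edge.2, Set.mem_univ, Set.mem_compl_iff]
  tauto

end Darts

section Components

open Graph

variable {α β : Type*} {G : Graph α β} {Q S T : Set α}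

lemma subset_of_mem_componentSets (hQ : Q ∈ G.componentSets) : Q ⊆ V(G) := by
  obtain ⟨x, hx, rfl⟩ := hQ
  intro y hy
  cases hy with
  | refl => exact hx
  | tail _ h => exact h.right_mem

lemma mem_of_adj_of_mem_componentSets (hQ : Q ∈ G.componentSets) {x y : α} (hx : x ∈ Q)
    (h : G.Adj x y) : y ∈ Q := by
  obtain ⟨z, -, rfl⟩ := hQ
  exact hx.tail h

lemma pairwiseDisjoint_componentSets : G.componentSets.PairwiseDisjoint id := by
  have hsymm {x y : α} (h : Relation.ReflTransGen G.Adj x y) : Relation.ReflTransGen G.Adj y x :=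
    symm h
  rintro _ ⟨x, -, rfl⟩ _ ⟨y, -, rfl⟩ hne
  refine Set.disjoint_left.2 fun z hxz hyz => hne (Set.ext fun w => ?_)
  exact ⟨fun h => (hyz.trans (hsymm hxz)).trans h, fun h => (hxz.trans (hsymm hyz)).trans h⟩

/-- The vertex sets of the components of `G - S - T`. -/
def splitComponents (G : Graph α β) (S T : Set α) : Set (Set α) :=
  ((G.deleteVerts S).deleteVerts T).componentSets

lemma subset_of_mem_splitComponents (hQ : Q ∈ splitComponents G S T) : Q ⊆ (V(G) \ S) \ T := by
  simpa using subset_of_mem_componentSets hQ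

lemma disjoint_left_of_mem_splitComponents (hQ : Q ∈ splitComponents G S T) : Disjoint Q S :=
  Set.disjoint_left.2 fun _ hx => (subset_of_mem_splitComponents hQ hx).1.2

lemma disjoint_right_of_mem_splitComponents (hQ : Q ∈ splitComponents G S T) : Disjoint Q T :=
  Set.disjoint_left.2 fun _ hx => (subset_of_mem_splitComponents hQ hx).2

lemma head_mem_of_mem_splitComponents (hQ : Q ∈ splitComponents G S T) {d : Dart G}
    (hd : d.tail ∈ Q) (hS : d.head ∉ S) (hT : d.head ∉ T) : d.head ∈ Q := by
  have hd' := subset_of_mem_splitComponents hQ hd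
  refine mem_of_adj_of_mem_componentSets hQ hd ⟨d.edge, ?_⟩
  simp only [deleteVerts_isLink]
  exact ⟨⟨d.isLink, hd'.1.2, hS⟩, hd'.2, hT⟩

lemma numDarts_univ_of_mem_splitComponents [Finite E(G)] {K : Set β} (hST : Disjoint S T)
    (hQ : Q ∈ splitComponents G S T) :
    numDarts G K Q .univ = numDarts G K Q Q + numDarts G K Q S + numDarts G K Q T := by
  have hQS := disjoint_left_of_mem_splitComponents hQ
  have hQT := disjoint_right_of_mem_splitComponents hQ
  rw [← numDarts_union_right hQS, ← numDarts_union_right (hQT.union_left hST), numDarts, numDarts]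
  congr 1
  ext d
  have hhead := head_mem_of_mem_splitComponents hQ (d := d)
  simp only [Set.mem_ofPred_eq, Set.mem_union, Set.mem_univ]
  tauto

end Components

section UpperBound

open Graph

variable {α β : Type*} {G H : Graph α β} {f : α → ℕ} {A Q S T : Set α}

lemma vertexSum_eq_add_add {g : α → ℕ} (hA : A.Finite) (hS : S ⊆ A) (hT : T ⊆ A)
    (hST : Disjoint S T) :
    vertexSum g A = vertexSum g ((A \ S) \ T) + vertexSum g S + vertexSum g T := by
  have hTS : T ⊆ A \ S := Set.subset_sdiff.2 ⟨hT, hST.symm⟩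
  have hAS : (A \ S).Finite := hA.subset Set.sdiff_subset
  nth_rw 1 [← Set.sdiff_union_of_subset hS, ← Set.sdiff_union_of_subset hTS]
  rw [vertexSum_union ((hAS.sdiff).union (hA.subset hT)) (hA.subset hS)
      (by rw [Set.sdiff_union_of_subset hTS]; exact Set.disjoint_sdiff_left),
    vertexSum_union hAS.sdiff (hA.subset hT) Set.disjoint_sdiff_left]
  omega

lemma ncard_le_vertexSum {g : α → ℕ} {𝒬 : Set (Set α)} (hA : A.Finite)
    (hsub : ∀ Q ∈ 𝒬, Q ⊆ A) (hdisj : 𝒬.PairwiseDisjoint id)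
    (hone : ∀ Q ∈ 𝒬, 1 ≤ vertexSum g Q) : 𝒬.ncard ≤ vertexSum g A := by
  have h𝒬 : 𝒬.Finite := hA.finite_subsets.subset hsub
  calc 𝒬.ncard = vertexSum (fun _ => 1) 𝒬 := finsum_one.symm
    _ ≤ vertexSum (vertexSum g) 𝒬 := vertexSum_mono h𝒬 hone
    _ = vertexSum g (⋃₀ 𝒬) := (finsum_mem_sUnion hdisj h𝒬 fun Q hQ => hA.subset (hsub Q hQ)).symm
    _ ≤ vertexSum g A := by
      have hunion : ⋃₀ 𝒬 ⊆ A := Set.sUnion_subset hsub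
      rw [← Set.union_sdiff_cancel hunion, vertexSum_union (hA.subset hunion)
        (hA.subset Set.sdiff_subset) Set.disjoint_sdiff_right]
      exact Nat.le_add_right _ _

/-- What a vertex `v` outside `S ∪ T` costs an `f`-bounded subgraph `H`: its missing degree, its
darts of `H` to `S`, and its darts to `T` that `H` omits. -/
noncomputable def slack (G H : Graph α β) (f : α → ℕ) (S T : Set α) (v : α) : ℕ :=
  (f v - H.degree v) + numDarts G E(H) {v} S + numDarts G E(H)ᶜ {v} T

variable [Finite E(G)]

lemma vertexSum_slack (hH : H.IsBoundedSubgraph G f) (hA : A.Finite) (hAV : A ⊆ V(G)) :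
    vertexSum (slack G H f S T) A + numDarts G E(H) A .univ =
      vertexSum f A + numDarts G E(H) A S + numDarts G E(H)ᶜ A T := by
  have hf : vertexSum f A =
      vertexSum (fun v => f v - H.degree v) A + numDarts G E(H) A .univ := by
    rw [← vertexSum_degree hH.1.le hA, ← vertexSum_add hA]
    exact vertexSum_congr fun v hv => (Nat.sub_add_cancel (hH.2 v (hAV hv))).symm
  unfold slack
  simp only [vertexSum_add hA, vertexSum_numDarts hA]
  omega

lemma one_le_vertexSum_slack (hH : H.IsBoundedSubgraph G f) (hV : V(G).Finite)
    (hST : Disjoint S T) (hQ : Q ∈ splitComponents G S T)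
    (hodd : Odd (vertexSum f Q + G.numEdgesBetween Q T)) : 1 ≤ vertexSum (slack G H f S T) Q := by
  have hQV : Q ⊆ V(G) := fun v hv => (subset_of_mem_splitComponents hQ hv).1.1
  have hslack := vertexSum_slack (S := S) (T := T) hH (hV.subset hQV) hQV
  have hdarts := numDarts_univ_of_mem_splitComponents (K := E(H)) hST hQ
  have hcompl := numDarts_add_numDarts_compl (G := G) (K := E(H)) (A := Q) (B := T)
  have heven := even_numDarts_self (G := G) (K := E(H)) (A := Q)
  rw [← numDarts_eq_numEdgesBetween (disjoint_right_of_mem_splitComponents hQ)] at hodd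
  by_contra! hzero
  rw [Nat.odd_iff] at hodd
  rw [Nat.even_iff] at heven
  omega

lemma numBad_le_vertexSum_slack (hH : H.IsBoundedSubgraph G f) (hV : V(G).Finite)
    (hST : Disjoint S T) : G.numBad f S T ≤ vertexSum (slack G H f S T) ((V(G) \ S) \ T) :=
  ncard_le_vertexSum (hV.subset fun _ hv => hv.1.1)
    (fun _ hQ => subset_of_mem_splitComponents hQ.1)
    (pairwiseDisjoint_componentSets.subset fun _ hQ => hQ.1)
    fun _ hQ => one_le_vertexSum_slack hH hV hST hQ.1 hQ.2

theorem deficiency_le_of_isBoundedSubgraph (hH : H.IsBoundedSubgraph G f) (hV : V(G).Finite)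
    (hS : S ⊆ V(G)) (hT : T ⊆ V(G)) (hST : Disjoint S T) :
    G.deficiency f S T ≤ vertexSum f V(G) - vertexSum H.degree V(H) := by
  let R := (V(G) \ S) \ T
  have hRV : R ⊆ V(G) := fun _ hv => hv.1.1
  have hRS : Disjoint R S := Set.disjoint_left.2 fun _ hv => hv.1.2
  have hRT : Disjoint R T := Set.disjoint_left.2 fun _ hv => hv.2
  have hf : vertexSum f V(G) = vertexSum f R + vertexSum f S + vertexSum f T :=
    vertexSum_eq_add_add hV hS hT hST
  have hdeg := vertexSum_eq_add_add (g := H.degree) hV hS hT hST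
  rw [vertexSum_degree hH.1.le (hV.subset hRV), vertexSum_degree hH.1.le (hV.subset hS),
    vertexSum_degree hH.1.le (hV.subset hT)] at hdeg
  have hbad : G.numBad f S T ≤ vertexSum (slack G H f S T) R := numBad_le_vertexSum_slack hH hV hST
  have hslack := vertexSum_slack (S := S) (T := T) hH (hV.subset hRV) hRV
  have hSf : numDarts G E(H) S .univ ≤ vertexSum f S := by
    rw [← vertexSum_degree hH.1.le (hV.subset hS)]
    exact vertexSum_mono (hV.subset hS) fun v hv => hH.2 v (hS hv)
  have hSR : numDarts G E(H) R S + numDarts G E(H) T S ≤ numDarts G E(H) S .univ := by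
    rw [← numDarts_union_left hRT, numDarts_comm]
    exact numDarts_mono subset_rfl (Set.subset_univ _)
  have hTS : numDarts G E(H) T .univ = numDarts G E(H) T S + numDarts G E(H) T Sᶜ := by
    rw [← numDarts_union_right disjoint_compl_right, Set.union_compl_self]
  have hTcompl := numDarts_add_numDarts_compl (G := G) (K := E(H)) (A := T) (B := Sᶜ)
  have hTR : numDarts G E(H)ᶜ R T ≤ numDarts G E(H)ᶜ T Sᶜ := by
    rw [numDarts_comm]
    exact numDarts_mono subset_rfl (Set.subset_compl_iff_disjoint_right.2 hRS)
  rw [deficiency, vertexSum_degree_deleteVerts (hV.subset hT) hST, hH.1.vertexSet_eq]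
  omega

end UpperBound

section Gadget

open Graph SimpleGraph

variable {α β : Type*} {G : Graph α β} {f : α → ℕ} {A : Set α} {D : Set (Dart G)}

/-- A vertex of `G` with multiplicity `f`: the copies of `v` are the places that an `f`-bounded
subgraph offers to the darts leaving `v`. -/
abbrev Copy (G : Graph α β) (f : α → ℕ) := Σ v : V(G), Fin (f v)

/-- The simple graph whose matchings encode the `f`-bounded subgraphs of `G`: every dart is joined
to its reverse and to all copies of the vertex it leaves. An edge of `G` is used by a matching if
both its darts are matched to copies. -/
def gadget (G : Graph α β) (f : α → ℕ) : SimpleGraph (Copy G f ⊕ Dart G) where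
  Adj
    | .inl p, .inr d => d.tail = p.1
    | .inr d, .inl p => d.tail = p.1
    | .inr d, .inr d' => d' = d.rev
    | .inl _, .inl _ => False
  symm := ⟨by rintro (p | d) (q | d') h <;> simp_all⟩
  loopless := ⟨by rintro (p | d) h; exacts [h, d.rev_ne h.symm]⟩

lemma gadget_adj_inr_inl {d : Dart G} {p : Copy G f} :
    (gadget G f).Adj (.inr d) (.inl p) ↔ d.tail = p.1 := .rfl

lemma gadget_adj_inr_inr {d d' : Dart G} :
    (gadget G f).Adj (.inr d) (.inr d') ↔ d' = d.rev := .rfl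

lemma not_gadget_adj_inl_inl {p q : Copy G f} : ¬ (gadget G f).Adj (.inl p) (.inl q) := id

/-- The set of gadget vertices consisting of the copies of the vertices in `A` and the darts
in `D`. -/
def gadgetSet (f : α → ℕ) (A : Set α) (D : Set (Dart G)) : Set (Copy G f ⊕ Dart G) :=
  {x | x.elim (fun p => ↑p.1 ∈ A) (· ∈ D)}

lemma inl_mem_gadgetSet {p : Copy G f} : .inl p ∈ gadgetSet f A D ↔ ↑p.1 ∈ A := .rfl

lemma ncard_copies_eq_vertexSum [Finite V(G)] (hA : A ⊆ V(G)) :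
    {p : Copy G f | ↑p.1 ∈ A}.ncard = vertexSum f A := by
  have hfiber (v : α) (hv : v ∈ A) : {p ∈ (.univ : Set (Copy G f)) | ↑p.1 = v}.ncard = f v := by
    have hrange : {p ∈ (.univ : Set (Copy G f)) | ↑p.1 = v} =
        Set.range (Sigma.mk (β := fun v : V(G) => Fin (f v)) ⟨v, hA hv⟩) := by
      ext p
      constructor
      · rintro ⟨-, rfl⟩
        exact ⟨p.2, rfl⟩
      · rintro ⟨i, rfl⟩
        exact ⟨trivial, rfl⟩
    rw [hrange, ← Set.image_univ, Set.ncard_image_of_injective _ sigma_mk_injective,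
      Set.ncard_univ, Nat.card_fin]
  simpa using ((vertexSum_congr hfiber).symm.trans
    (vertexSum_ncard_fiber Set.finite_univ _ (Set.Finite.subset (Set.toFinite _) hA))).symm

lemma ncard_gadgetSet [Finite V(G)] [Finite E(G)] (hA : A ⊆ V(G)) :
    (gadgetSet f A D).ncard = vertexSum f A + D.ncard := by
  rw [ncard_eq_ncard_preimage_inl_add, ← ncard_copies_eq_vertexSum hA]
  rfl

lemma exists_eq_gadgetSet {X : Set (Copy G f ⊕ Dart G)}
    (hX : ∀ x ∈ X, MeetsThreeComponents (gadget G f) X x) :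
    ∃ S T : Set α, S ⊆ V(G) ∧ T ⊆ V(G) ∧ Disjoint S T ∧ X = gadgetSet f S {d | d.tail ∈ T} ∧
      (∀ v ∈ V(G), v ∉ S → 0 < f v) ∧
      ∀ v ∈ V(G), v ∉ S → v ∉ T → ∃ d : Dart G, d.tail = v := by
  let S : Set α := {v | ∃ hv : v ∈ V(G), ∀ i, .inl ⟨⟨v, hv⟩, i⟩ ∈ X}
  let T : Set α := {v | v ∈ V(G) ∧ v ∉ S ∧ ∀ d : Dart G, d.tail = v → .inr d ∈ X}
  have hcopy (p : Copy G f) (hp : .inl p ∈ X) : ↑p.1 ∈ S := by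
    refine ⟨p.1.2, fun i => ?_⟩
    by_contra hi
    obtain ⟨q | d, hpd, hdX, hreach, -⟩ := hX _ hp (.inl ⟨p.1, i⟩) (.inl ⟨p.1, i⟩)
    · exact not_gadget_adj_inl_inl hpd
    · exact hreach (Adj.reachable ⟨hpd, hi, hdX⟩)
  have hdart (d : Dart G) (hd : .inr d ∈ X) : d.tail ∈ T := by
    have hnbr (x : Copy G f ⊕ Dart G) : ∃ p : Copy G f, d.tail = p.1 ∧ .inl p ∉ X ∧
        ¬ (isolate (gadget G f) X).Reachable x (.inl p) := by
      obtain ⟨p | d', hdp, hpX, hrev, hreach⟩ := hX _ hd (.inr d.rev) x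
      · exact ⟨p, hdp, hpX, hreach⟩
      · rw [gadget_adj_inr_inr.1 hdp] at hrev
        exact (hrev .rfl).elim
    refine ⟨d.isLink.left_mem, ?_, fun d' hd' => ?_⟩
    · rintro ⟨_, hS⟩
      obtain ⟨⟨⟨v, hv'⟩, i⟩, rfl, hpX, -⟩ := hnbr (.inr d)
      exact hpX (hS i)
    · by_contra hd'X
      obtain ⟨p, hp, hpX, hreach⟩ := hnbr (.inr d')
      exact hreach (Adj.reachable ⟨hd'.trans hp, hd'X, hpX⟩)
  refine ⟨S, T, fun v hv => hv.1, fun v hv => hv.1, ?_, ?_, ?_, ?_⟩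
  · exact Set.disjoint_right.2 fun v hv => hv.2.1
  · ext (p | d)
    · exact ⟨hcopy p, fun hp => hp.2 p.2⟩
    · exact ⟨hdart d, fun hd => hd.2.2 d rfl⟩
  · intro v hv hS
    by_contra! hzero
    exact hS ⟨hv, fun i => (i.2.not_ge (hzero.trans i.val.zero_le)).elim⟩
  · intro v hv hS hT
    by_contra! hdeg
    exact hT ⟨hv, hS, fun d hd => (hdeg d hd).elim⟩

end Gadget

section SplitGadget

open Graph SimpleGraph

variable {α β : Type*} {G : Graph α β} {f : α → ℕ} {A B Q S T : Set α}

lemma exists_mem_splitComponents {v : α} (hv : v ∈ V(G)) (hS : v ∉ S) (hT : v ∉ T) :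
    ∃ Q ∈ splitComponents G S T, v ∈ Q :=
  ⟨_, ⟨v, by simp [hv, hS, hT], rfl⟩, .refl⟩

/-- The gadget without the edges that meet the vertex set formed by the copies of vertices in `S`
and the darts leaving `T`. -/
def splitGadget (G : Graph α β) (f : α → ℕ) (S T : Set α) : SimpleGraph (Copy G f ⊕ Dart G) :=
  isolate (gadget G f) (gadgetSet f S {d | d.tail ∈ T})

lemma splitGadget_adj_inr_inl {d : Dart G} {p : Copy G f} :
    (splitGadget G f S T).Adj (.inr d) (.inl p) ↔ d.tail = p.1 ∧ d.tail ∉ T ∧ ↑p.1 ∉ S := .rfl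

lemma splitGadget_adj_inl_inr {d : Dart G} {p : Copy G f} :
    (splitGadget G f S T).Adj (.inl p) (.inr d) ↔ d.tail = p.1 ∧ ↑p.1 ∉ S ∧ d.tail ∉ T := .rfl

lemma splitGadget_adj_inr_inr {d d' : Dart G} :
    (splitGadget G f S T).Adj (.inr d) (.inr d') ↔ d' = d.rev ∧ d.tail ∉ T ∧ d'.tail ∉ T := .rfl

/-- The vertices of `splitGadget G f S T` without neighbours. -/
def isolatedSet (f : α → ℕ) (S T : Set α) : Set (Copy G f ⊕ Dart G) :=
  gadgetSet f (S ∪ T) {d | d.tail ∈ T ∨ d.tail ∈ S ∧ d.head ∈ T}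

lemma not_adj_of_mem_isolatedSet {x : Copy G f ⊕ Dart G} (hx : x ∈ isolatedSet f S T)
    (y : Copy G f ⊕ Dart G) : ¬ (splitGadget G f S T).Adj x y := by
  intro hxy
  rcases x with p | d <;> rcases y with q | d'
  · exact not_gadget_adj_inl_inl hxy.1
  · obtain ⟨htail, hS, hT⟩ := splitGadget_adj_inl_inr.1 hxy
    exact hx.elim hS (htail ▸ hT)
  · obtain ⟨htail, hT, hS⟩ := splitGadget_adj_inr_inl.1 hxy
    exact hx.elim hT fun h => hS (htail ▸ h.1)
  · obtain ⟨rfl, hT, hT'⟩ := splitGadget_adj_inr_inr.1 hxy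
    exact hx.elim hT fun h => hT' h.2

lemma supp_splitGadget_of_tail_mem_of_head_mem (hST : Disjoint S T) {d : Dart G}
    (htail : d.tail ∈ S) (hhead : d.head ∈ S) :
    ((splitGadget G f S T).connectedComponentMk (.inr d)).supp = {.inr d, .inr d.rev} := by
  have hT : ∀ v ∈ S, v ∉ T := fun v hv => Set.disjoint_left.1 hST hv
  have hclosed : ∀ d' : Dart G, d'.tail ∈ S → ∀ y, (splitGadget G f S T).Adj (.inr d') y →
      y = .inr d'.rev := by
    rintro d' hd' (p | d'') hadj
    · obtain ⟨htail, -, hS⟩ := splitGadget_adj_inr_inl.1 hadj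
      exact (hS (htail ▸ hd')).elim
    · exact congrArg Sum.inr hadj.1
  refine supp_eq_of_closed (.inl rfl) ?_ ?_
  · rintro _ (rfl | rfl) y hy
    · exact .inr (hclosed d htail y hy)
    · exact .inl ((hclosed d.rev hhead y hy).trans (by rw [Dart.rev_rev]))
  · rintro _ (rfl | rfl)
    · exact .rfl
    · exact Adj.reachable (splitGadget_adj_inr_inr.2 ⟨rfl, hT _ htail, hT _ hhead⟩)

/-- The component of `splitGadget G f S T` belonging to a component `Q` of `G - S - T`. -/
def gadgetComponent (f : α → ℕ) (S Q : Set α) : Set (Copy G f ⊕ Dart G) :=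
  gadgetSet f Q {d | d.tail ∈ Q ∨ d.tail ∈ S ∧ d.head ∈ Q}

lemma mem_gadgetComponent_of_adj (hQ : Q ∈ splitComponents G S T) {x y : Copy G f ⊕ Dart G}
    (hx : x ∈ gadgetComponent f S Q) (hxy : (splitGadget G f S T).Adj x y) :
    y ∈ gadgetComponent f S Q := by
  rcases x with p | d <;> rcases y with q | d'
  · exact (not_gadget_adj_inl_inl hxy.1).elim
  · obtain ⟨htail, -⟩ := splitGadget_adj_inl_inr.1 hxy
    exact .inl (htail ▸ hx)
  · obtain ⟨htail, -, hS⟩ := splitGadget_adj_inr_inl.1 hxy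
    exact hx.elim (fun h => inl_mem_gadgetSet.2 (htail ▸ h)) fun h => (hS (htail ▸ h.1)).elim
  · obtain ⟨rfl, -, hT⟩ := splitGadget_adj_inr_inr.1 hxy
    rcases hx with hx | hx
    · by_cases hS : d.head ∈ S
      · exact .inr ⟨hS, by rwa [Dart.head_rev]⟩
      · exact .inl (head_mem_of_mem_splitComponents hQ hx hS hT)
    · exact .inl hx.2

lemma reachable_copies_of_mem_splitComponents (hpos : ∀ v ∈ V(G), v ∉ S → 0 < f v)
    (hdart : ∀ v ∈ V(G), v ∉ S → v ∉ T → ∃ d : Dart G, d.tail = v)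
    (hQ : Q ∈ splitComponents G S T) :
    ∃ p : Copy G f, ∀ q : Copy G f, ↑q.1 ∈ Q →
      (splitGadget G f S T).Reachable (.inl p) (.inl q) := by
  obtain ⟨x, hx, rfl⟩ := hQ
  simp only [vertexSet_deleteVerts, Set.mem_sdiff] at hx
  refine ⟨⟨⟨x, hx.1.1⟩, ⟨0, hpos x hx.1.1 hx.1.2⟩⟩, fun ⟨⟨y, hyV⟩, i⟩ hy => ?_⟩
  change Relation.ReflTransGen _ x y at hy
  induction hy with
  | refl =>
    obtain ⟨d, hd⟩ := hdart x hx.1.1 hx.1.2 hx.2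
    subst hd
    exact (Adj.reachable (splitGadget_adj_inl_inr.2 ⟨rfl, hx.1.2, hx.2⟩)).trans
      (Adj.reachable (splitGadget_adj_inr_inl.2 ⟨rfl, hx.2, hx.1.2⟩))
  | @tail b c _ hbc ih =>
    obtain ⟨e, he⟩ := hbc
    simp only [deleteVerts_isLink] at he
    obtain ⟨⟨he, hbS, hcS⟩, hbT, hcT⟩ := he
    obtain ⟨d, rfl, rfl, rfl⟩ := Dart.exists_of_isLink he
    have hfirst : (splitGadget G f S T).Adj
        (.inl ⟨⟨d.tail, he.left_mem⟩, ⟨0, hpos _ he.left_mem hbS⟩⟩) (.inr d) := ⟨rfl, hbS, hbT⟩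
    have hmid : (splitGadget G f S T).Adj (.inr d) (.inr d.rev) := ⟨rfl, hbT, hcT⟩
    have hlast : (splitGadget G f S T).Adj (.inr d.rev) (.inl ⟨⟨d.head, hyV⟩, i⟩) :=
      ⟨rfl, hcT, hcS⟩
    exact (ih he.left_mem ⟨0, hpos _ he.left_mem hbS⟩).trans
      (hfirst.reachable.trans (hmid.reachable.trans hlast.reachable))

lemma supp_eq_gadgetComponent (hST : Disjoint S T) (hpos : ∀ v ∈ V(G), v ∉ S → 0 < f v)
    (hdart : ∀ v ∈ V(G), v ∉ S → v ∉ T → ∃ d : Dart G, d.tail = v)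
    (hQ : Q ∈ splitComponents G S T) {x : Copy G f ⊕ Dart G} (hx : x ∈ gadgetComponent f S Q) :
    ((splitGadget G f S T).connectedComponentMk x).supp = gadgetComponent f S Q := by
  obtain ⟨p, hcopy⟩ := reachable_copies_of_mem_splitComponents hpos hdart hQ
  have hleave (d : Dart G) (hd : d.tail ∈ Q) :
      (splitGadget G f S T).Reachable (.inl p) (.inr d) := by
    obtain ⟨⟨hV, hS⟩, hT⟩ := subset_of_mem_splitComponents hQ hd
    have hadj : (splitGadget G f S T).Adj (.inl ⟨⟨d.tail, hV⟩, ⟨0, hpos _ hV hS⟩⟩) (.inr d) :=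
      ⟨rfl, hS, hT⟩
    exact (hcopy _ hd).trans hadj.reachable
  have hreach : ∀ y ∈ gadgetComponent f S Q, (splitGadget G f S T).Reachable (.inl p) y := by
    rintro (q | d) hy
    · exact hcopy q hy
    rcases hy with htail | ⟨htail, hhead⟩
    · exact hleave d htail
    · have hadj : (splitGadget G f S T).Adj (.inr d.rev) (.inr d) :=
        ⟨d.rev_rev.symm, (subset_of_mem_splitComponents hQ hhead).2, Set.disjoint_left.1 hST htail⟩
      exact (hleave d.rev hhead).trans hadj.reachable
  exact supp_eq_of_closed hx (fun y hy z hyz => mem_gadgetComponent_of_adj hQ hy hyz)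
    fun y hy => (hreach x hx).symm.trans (hreach y hy)

lemma mem_isolatedSet_or_mem_gadgetComponent (x : Copy G f ⊕ Dart G) :
    x ∈ isolatedSet f S T ∨ (∃ Q ∈ splitComponents G S T, x ∈ gadgetComponent f S Q) ∨
      ∃ d : Dart G, x = .inr d ∧ d.tail ∈ S ∧ d.head ∈ S := by
  rcases x with p | d
  · by_cases hp : ↑p.1 ∈ S ∪ T
    · exact .inl hp
    obtain ⟨Q, hQ, hpQ⟩ := exists_mem_splitComponents p.1.2 (fun h => hp (.inl h))
      (fun h => hp (.inr h))
    exact .inr (.inl ⟨Q, hQ, hpQ⟩)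
  by_cases htailT : d.tail ∈ T
  · exact .inl (.inl htailT)
  by_cases htailS : d.tail ∉ S
  · obtain ⟨Q, hQ, hdQ⟩ := exists_mem_splitComponents d.isLink.left_mem htailS htailT
    exact .inr (.inl ⟨Q, hQ, .inl hdQ⟩)
  rw [not_not] at htailS
  by_cases hheadT : d.head ∈ T
  · exact .inl (.inr ⟨htailS, hheadT⟩)
  by_cases hheadS : d.head ∈ S
  · exact .inr (.inr ⟨d, rfl, htailS, hheadS⟩)
  obtain ⟨Q, hQ, hdQ⟩ := exists_mem_splitComponents d.isLink.right_mem hheadS hheadT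
  exact .inr (.inl ⟨Q, hQ, .inr ⟨htailS, hdQ⟩⟩)

variable [Finite E(G)]

lemma ncard_setOf_tail_mem_or (h : Disjoint A B) :
    {d : Dart G | d.tail ∈ A ∨ d.tail ∈ B ∧ d.head ∈ Q}.ncard =
      numDarts G E(G) A .univ + numDarts G E(G) B Q := by
  rw [numDarts, numDarts, ← Set.ncard_union_eq]
  · congr 1
    ext d
    simp
  · exact Set.disjoint_left.2 fun d hd hd' => Set.disjoint_left.1 h hd.2.1 hd'.2.1

variable [Finite V(G)]

lemma odd_ncard_gadgetComponent_iff (hST : Disjoint S T) (hQ : Q ∈ splitComponents G S T) :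
    Odd (gadgetComponent (G := G) f S Q).ncard ↔ Odd (vertexSum f Q + G.numEdgesBetween Q T) := by
  have hQV : Q ⊆ V(G) := fun v hv => (subset_of_mem_splitComponents hQ hv).1.1
  have hcard : (gadgetComponent (G := G) f S Q).ncard =
      vertexSum f Q + (numDarts G E(G) Q .univ + numDarts G E(G) S Q) := by
    rw [gadgetComponent, ncard_gadgetSet hQV,
      ncard_setOf_tail_mem_or (disjoint_left_of_mem_splitComponents hQ)]
  have huniv := numDarts_univ_of_mem_splitComponents (K := E(G)) hST hQ
  have hQS := numDarts_comm (G := G) (K := E(G)) (A := Q) (B := S)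
  have heven := even_numDarts_self (G := G) (K := E(G)) (A := Q)
  rw [hcard, ← numDarts_eq_numEdgesBetween (disjoint_right_of_mem_splitComponents hQ)]
  rw [Nat.even_iff] at heven
  simp only [Nat.odd_iff]
  omega

lemma ncard_isolatedSet (hS : S ⊆ V(G)) (hT : T ⊆ V(G)) (hST : Disjoint S T) :
    (isolatedSet (G := G) f S T).ncard = vertexSum f S + vertexSum f T +
      (numDarts G E(G) T .univ + numDarts G E(G) S T) := by
  have hV : V(G).Finite := Set.toFinite _
  rw [isolatedSet, ncard_gadgetSet (Set.union_subset hS hT), ncard_setOf_tail_mem_or hST.symm,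
    vertexSum_union (hV.subset hS) (hV.subset hT) hST]

lemma ncard_oddComponents_splitGadget_le (hST : Disjoint S T)
    (hpos : ∀ v ∈ V(G), v ∉ S → 0 < f v)
    (hdart : ∀ v ∈ V(G), v ∉ S → v ∉ T → ∃ d : Dart G, d.tail = v) :
    (splitGadget G f S T).oddComponents.ncard ≤
      (isolatedSet (G := G) f S T).ncard + G.numBad f S T := by
  let bad : Set (Set α) :=
    {Q | Q ∈ splitComponents G S T ∧ Odd (vertexSum f Q + G.numEdgesBetween Q T)}
  have hbad : bad.Finite := (Set.toFinite V(G)).finite_subsets.subset fun Q hQ v hv =>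
    (subset_of_mem_splitComponents hQ.1 hv).1.1
  have hsub : ConnectedComponent.supp '' (splitGadget G f S T).oddComponents ⊆
      (fun x => {x}) '' isolatedSet f S T ∪ gadgetComponent f S '' bad := by
    rintro _ ⟨c, hc, rfl⟩
    rw [Set.mem_ofPred_eq] at hc
    induction c using ConnectedComponent.ind with | _ x
    rcases mem_isolatedSet_or_mem_gadgetComponent (S := S) (T := T) x with
      hx | ⟨Q, hQ, hx⟩ | ⟨d, rfl, htail, hhead⟩
    · exact .inl ⟨x, hx, (supp_eq_singleton (not_adj_of_mem_isolatedSet hx)).symm⟩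
    · have hsupp := supp_eq_gadgetComponent hST hpos hdart hQ hx
      rw [hsupp, odd_ncard_gadgetComponent_iff hST hQ] at hc
      exact .inr ⟨Q, ⟨hQ, hc⟩, hsupp.symm⟩
    · have hne : (Sum.inr d : Copy G f ⊕ Dart G) ≠ .inr d.rev :=
        fun h => d.rev_ne (Sum.inr_injective h).symm
      rw [supp_splitGadget_of_tail_mem_of_head_mem hST htail hhead, Set.ncard_pair hne] at hc
      exact absurd hc (by decide)
  rw [← Set.ncard_image_of_injective _ ConnectedComponent.supp_injective]
  exact (Set.ncard_le_ncard hsub).trans ((Set.ncard_union_le _ _).trans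
    (add_le_add (Set.ncard_image_le) (Set.ncard_image_le hbad)))

lemma le_deficiency_of_two_mul_ncard_add_le (hS : S ⊆ V(G)) (hT : T ⊆ V(G)) (hST : Disjoint S T)
    (hpos : ∀ v ∈ V(G), v ∉ S → 0 < f v)
    (hdart : ∀ v ∈ V(G), v ∉ S → v ∉ T → ∃ d : Dart G, d.tail = v) {k : ℕ}
    (hk : 2 * (gadgetSet (G := G) f S {d | d.tail ∈ T}).ncard + k ≤
      (splitGadget G f S T).oddComponents.ncard) : k ≤ G.deficiency f S T := by
  have hle := ncard_oddComponents_splitGadget_le hST hpos hdart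
  have hX : (gadgetSet (G := G) f S {d | d.tail ∈ T}).ncard =
      vertexSum f S + numDarts G E(G) T .univ := by
    rw [ncard_gadgetSet hS, numDarts]
    simp
  have hTS : numDarts G E(G) T .univ = numDarts G E(G) T S + numDarts G E(G) T Sᶜ := by
    rw [← numDarts_union_right disjoint_compl_right, Set.union_compl_self]
  have hcomm := numDarts_comm (G := G) (K := E(G)) (A := S) (B := T)
  rw [ncard_isolatedSet hS hT hST] at hle
  rw [deficiency, vertexSum_degree_deleteVerts ((Set.toFinite V(G)).subset hT) hST]
  omega

end SplitGadget

section Matching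

open Graph SimpleGraph

variable {α β : Type*} {G : Graph α β} {f : α → ℕ} {M : (gadget G f).Subgraph}

/-- The darts that `M` matches to copies of the vertices they leave. -/
def matchedDarts (M : (gadget G f).Subgraph) : Set (Dart G) := {d | ∃ p, M.Adj (.inr d) (.inl p)}

/-- The spanning subgraph of `G` encoded by a matching `M` of the gadget: its edges are those with
both darts matched to copies. -/
def matchedSubgraph (M : (gadget G f).Subgraph) : Graph α β :=
  G.restrict {e | ∀ d : Dart G, ↑d.edge = e → d ∈ matchedDarts M}

lemma matchedSubgraph_isSpanningSubgraph : (matchedSubgraph M).IsSpanningSubgraph G :=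
  ⟨restrict_le, rfl⟩

lemma edge_mem_edgeSet_matchedSubgraph {d : Dart G} :
    ↑d.edge ∈ E(matchedSubgraph M) ↔ d ∈ matchedDarts M ∧ d.rev ∈ matchedDarts M := by
  simp only [matchedSubgraph, edgeSet_restrict, Set.mem_inter_iff, d.edge.2, Set.mem_ofPred_eq,
    true_and]
  refine ⟨fun h => ⟨h d rfl, h d.rev rfl⟩, fun h d' hd' => ?_⟩
  rcases Dart.eq_or_eq_rev (Subtype.ext hd') with rfl | rfl
  exacts [h.1, h.2]

lemma inr_rev_notMem_verts (hM : M.IsMatching) {d : Dart G} (hd : d ∈ matchedDarts M)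
    (hrev : d.rev ∉ matchedDarts M) : .inr d.rev ∉ M.verts := by
  intro hverts
  obtain ⟨p, hp⟩ := hd
  obtain ⟨q | d', hq, -⟩ := hM hverts
  · exact hrev ⟨q, hq⟩
  · obtain rfl : d' = d := (gadget_adj_inr_inr.1 (M.adj_sub hq)).trans d.rev_rev
    exact Sum.inl_ne_inr (hM.eq_of_adj_left hp hq.symm)

variable [Finite V(G)] [Finite E(G)]

lemma isBoundedSubgraph_matchedSubgraph (hM : M.IsMatching) :
    (matchedSubgraph M).IsBoundedSubgraph G f := by
  refine ⟨matchedSubgraph_isSpanningSubgraph, fun v hv => ?_⟩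
  calc (matchedSubgraph M).degree v = numDarts G E(matchedSubgraph M) {v} .univ :=
        degree_eq_numDarts matchedSubgraph_isSpanningSubgraph.le v
    _ = (Sum.inr '' {d : Dart G | ↑d.edge ∈ E(matchedSubgraph M) ∧ d.tail ∈ ({v} : Set α) ∧
          d.head ∈ Set.univ} : Set (Copy G f ⊕ Dart G)).ncard :=
        (Set.ncard_image_of_injective _ Sum.inr_injective).symm
    _ ≤ (Sum.inl '' {p : Copy G f | ↑p.1 ∈ ({v} : Set α)}).ncard := by
        refine ncard_le_ncard_of_isMatching hM ?_
        rintro _ ⟨d, ⟨hd, htail, -⟩, rfl⟩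
        obtain ⟨p, hp⟩ := (edge_mem_edgeSet_matchedSubgraph.1 hd).1
        exact ⟨_, ⟨p, (gadget_adj_inr_inl.1 (M.adj_sub hp)).symm.trans htail, rfl⟩, hp⟩
    _ = vertexSum f {v} := by
        rw [Set.ncard_image_of_injective _ Sum.inl_injective,
          ncard_copies_eq_vertexSum (Set.singleton_subset_iff.2 hv)]
    _ = f v := finsum_mem_singleton

lemma ncard_matchedDarts_le (hM : M.IsMatching) :
    (matchedDarts M).ncard ≤
      vertexSum (matchedSubgraph M).degree V(matchedSubgraph M) + (Sum.inr ⁻¹' M.vertsᶜ).ncard := by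
  have hboth : {d ∈ matchedDarts M | d.rev ∈ matchedDarts M}.ncard =
      vertexSum (matchedSubgraph M).degree V(matchedSubgraph M) := by
    have hM := matchedSubgraph_isSpanningSubgraph (M := M)
    rw [hM.vertexSet_eq, vertexSum_degree hM.le (Set.toFinite _), numDarts_vertexSet_left]
    simp [numDarts, edge_mem_edgeSet_matchedSubgraph]
  have hhalf : (matchedDarts M \ {d | d.rev ∈ matchedDarts M}).ncard ≤
      (Sum.inr ⁻¹' M.vertsᶜ).ncard :=
    Set.ncard_le_ncard_of_injOn Dart.rev (fun d hd => inr_rev_notMem_verts hM hd.1 hd.2)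
      (Function.Involutive.injective Dart.rev_rev).injOn
  rw [← hboth]
  exact (Set.ncard_inter_add_ncard_sdiff_eq_ncard _ _).symm.trans_le (Nat.add_le_add_left hhalf _)

lemma vertexSum_le_vertexSum_degree_add (hM : M.IsMatching) :
    vertexSum f V(G) ≤
      vertexSum (matchedSubgraph M).degree V(matchedSubgraph M) + M.vertsᶜ.ncard := by
  have hcopies : (Sum.inl ⁻¹' M.verts : Set (Copy G f)).ncard ≤ (matchedDarts M).ncard := by
    rw [← Set.ncard_image_of_injective _ (Sum.inl_injective (β := Dart G)),
      ← Set.ncard_image_of_injective (matchedDarts M) Sum.inr_injective]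
    refine ncard_le_ncard_of_isMatching hM ?_
    rintro _ ⟨p, hp, rfl⟩
    obtain ⟨q | d, hpq, -⟩ := hM hp
    · exact (not_gadget_adj_inl_inl (M.adj_sub hpq)).elim
    · exact ⟨_, ⟨d, ⟨p, hpq.symm⟩, rfl⟩, hpq⟩
  have hsum : vertexSum f V(G) =
      (Sum.inl ⁻¹' M.verts : Set (Copy G f)).ncard + (Sum.inl ⁻¹' M.vertsᶜ).ncard := by
    rw [Set.preimage_compl, Set.ncard_add_ncard_compl, ← ncard_copies_eq_vertexSum subset_rfl]
    simp
  have hunmatched := ncard_eq_ncard_preimage_inl_add M.vertsᶜ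
  have hdarts := ncard_matchedDarts_le hM
  omega

theorem exists_vertexSum_sub_vertexSum_degree_eq_deficiency (G : Graph α β) [Finite V(G)]
    [Finite E(G)] (f : α → ℕ) :
    ∃ (H : Graph α β) (S T : Set α), H.IsBoundedSubgraph G f ∧ S ⊆ V(G) ∧ T ⊆ V(G) ∧
      Disjoint S T ∧ (vertexSum f V(G) : ℤ) - vertexSum H.degree V(H) = G.deficiency f S T := by
  obtain ⟨X, M, hX, hM, hcard⟩ := exists_barrier_and_isMatching (gadget G f)
  obtain ⟨S, T, hS, hT, hST, rfl, hpos, hdart⟩ := exists_eq_gadgetSet hX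
  have hH := isBoundedSubgraph_matchedSubgraph hM
  refine ⟨matchedSubgraph M, S, T, hH, hS, hT, hST, le_antisymm ?_ ?_⟩
  · have hunmatched := vertexSum_le_vertexSum_degree_add hM
    have hdef := le_deficiency_of_two_mul_ncard_add_le hS hT hST hpos hdart hcard
    omega
  · exact deficiency_le_of_isBoundedSubgraph hH (Set.toFinite _) hS hT hST

end Matching

end BoundedSubgraph

theorem theorem3p1 {α β : Type*} (G : Graph α β) (hV : G.vertexSet.Finite)
    (hE : G.edgeSet.Finite) (f : α → ℕ) :
    (∃ h : ℕ,
      IsGreatest {d : ℕ | ∃ H : Graph α β, H.IsBoundedSubgraph G f ∧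
        d = Graph.vertexSum H.degree H.vertexSet} h ∧
      IsLeast {z : ℤ | ∃ S T : Set α, S ⊆ G.vertexSet ∧ T ⊆ G.vertexSet ∧ Disjoint S T ∧
        z = (Graph.vertexSum f G.vertexSet : ℤ) - G.deficiency f S T} (h : ℤ)) ∧
    (∃ (m : ℕ) (γ : ℤ),
      IsGreatest {k : ℕ | ∃ H : Graph α β, H.IsBoundedSubgraph G f ∧ k = H.edgeSet.ncard} m ∧
      IsGreatest {z : ℤ | ∃ S T : Set α, S ⊆ G.vertexSet ∧ T ⊆ G.vertexSet ∧ Disjoint S T ∧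
        z = G.deficiency f S T} γ ∧
      (m : ℚ) = 1 / 2 * ((Graph.vertexSum f G.vertexSet : ℚ) - (γ : ℚ))) := by
  have := hV.to_subtype
  have := hE.to_subtype
  have hedges (H : Graph α β) (hH : H.IsBoundedSubgraph G f) :
      Graph.vertexSum H.degree H.vertexSet = 2 * H.edgeSet.ncard := by
    have := (hE.subset hH.1.le.edgeSet_mono).to_subtype
    exact BoundedSubgraph.vertexSum_degree_vertexSet (hH.1.vertexSet_eq ▸ hV)
  have hle (H : Graph α β) (hH : H.IsBoundedSubgraph G f) {S T : Set α} :=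
    BoundedSubgraph.deficiency_le_of_isBoundedSubgraph hH hV (S := S) (T := T)
  obtain ⟨H, S, T, hH, hS, hT, hST, heq⟩ :=
    BoundedSubgraph.exists_vertexSum_sub_vertexSum_degree_eq_deficiency G f
  refine ⟨⟨_, ⟨⟨H, hH, rfl⟩, ?_⟩, ⟨S, T, hS, hT, hST, by omega⟩, ?_⟩,
    _, _, ⟨⟨H, hH, rfl⟩, ?_⟩, ⟨⟨S, T, hS, hT, hST, rfl⟩, ?_⟩, ?_⟩
  · rintro _ ⟨H', hH', rfl⟩
    linarith [hle H' hH' hS hT hST]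
  · rintro _ ⟨S', T', hS', hT', hST', rfl⟩
    linarith [hle H hH hS' hT' hST']
  · rintro _ ⟨H', hH', rfl⟩
    linarith [hle H' hH' hS hT hST, hedges H hH, hedges H' hH']
  · rintro _ ⟨S', T', hS', hT', hST', rfl⟩
    linarith [hle H hH hS' hT' hST']
  · rw [← heq, hedges H hH]
    push_cast
    ring
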